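/- Let $\xi$ be an EA-stable generic configuration, with formulas as above. Then $\mathrm{Prf}_{\alpha,d}(t,p)$ defines in $\mathbb N$ the relation "$p$ is a proof of $t$ from $\alpha$", and there is an algorithm $T$, namely $\Psi\ \longmapsto\ \Psi^T=\forall x\,\mathrm{Test}_0^\xi(\overline{\ulcorner\Psi\urcorner},x)$ (computable on Gödel numbers), such that, for all $\Pi_1^\xi$ sentences $\Psi$: for every $x\in\mathbb N$, $\mathrm{Test}_0^\xi(\ulcorner\Psi\urcorner,x)$ is true iff $x$ is not a proof from $B^\xi$ of the negation of $\Psi$; $\Psi^T$ is a $\Pi_1^\xi$ sentence; $\Psi^T$ is true in $\mathbb N$ iff $\Psi$ is; and $\alpha$ proves (by $d$) $\forall p\,[\,\mathrm{Prf}_{\alpha,d}(\overline{\ulcorner\Psi\urcorner},p)\rightarrow\Psi^T\,]$. -/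

import Mathlib

/-! ### Formulas with unbounded and bounded quantifiers -/

/-- First-order formulas of the language `L` whose free variables are among `v₀, …, v₍ₙ₋₁₎`.
A quantifier applied to a formula in `n + 1` variables binds the last one. Besides the
unbounded quantifiers there are the bounded ones `∀ v ≤ t` and `∃ v ≤ t`, with `t` a term in
the remaining variables. The symbol `≤` is one of the relation symbols of the language. -/
inductive Fml (L : FirstOrder.Language.{0, 0}) : ℕ → Type
  | eq {n : ℕ} (s t : L.Term (Fin n)) : Fml L n
  | rel {n k : ℕ} (R : L.Relations k) (ts : Fin k → L.Term (Fin n)) : Fml L n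
  | neg {n : ℕ} (φ : Fml L n) : Fml L n
  | and {n : ℕ} (φ ψ : Fml L n) : Fml L n
  | or {n : ℕ} (φ ψ : Fml L n) : Fml L n
  | imp {n : ℕ} (φ ψ : Fml L n) : Fml L n
  | all {n : ℕ} (φ : Fml L (n + 1)) : Fml L n
  | ex {n : ℕ} (φ : Fml L (n + 1)) : Fml L n
  | ball {n : ℕ} (t : L.Term (Fin n)) (φ : Fml L (n + 1)) : Fml L n
  | bex {n : ℕ} (t : L.Term (Fin n)) (φ : Fml L (n + 1)) : Fml L n

namespace Fml

variable {L : FirstOrder.Language.{0, 0}}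

/-- Truth of a formula in an `L`-structure `M`, where the equality sign denotes the relation `E`,
bounded quantifiers refer to the relation named by the symbol `le`, and the *unbounded*
quantifiers range over `D ⊆ M` only (bounded quantifiers are not affected by `D`). -/
def Realize {M : Type} [L.Structure M] (le : L.Relations 2) (E : M → M → Prop) (D : Set M) :
    {n : ℕ} → Fml L n → (Fin n → M) → Prop
  | _, eq s t, v => E (s.realize v) (t.realize v)
  | _, rel R ts, v => FirstOrder.Language.Structure.RelMap R (fun i => (ts i).realize v)
  | _, neg φ, v => ¬ Realize le E D φ v
  | _, and φ ψ, v => Realize le E D φ v ∧ Realize le E D ψ v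
  | _, or φ ψ, v => Realize le E D φ v ∨ Realize le E D ψ v
  | _, imp φ ψ, v => Realize le E D φ v → Realize le E D ψ v
  | _, all φ, v => ∀ a ∈ D, Realize le E D φ (Fin.snoc (α := fun _ => M) v a)
  | _, ex φ, v => ∃ a ∈ D, Realize le E D φ (Fin.snoc (α := fun _ => M) v a)
  | _, ball t φ, v => ∀ a, FirstOrder.Language.Structure.RelMap le ![a, t.realize v] →
      Realize le E D φ (Fin.snoc (α := fun _ => M) v a)
  | _, bex t φ, v => ∃ a, FirstOrder.Language.Structure.RelMap le ![a, t.realize v] ∧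
      Realize le E D φ (Fin.snoc (α := fun _ => M) v a)

/-- A formula is fully bounded if all its quantifiers are bounded. -/
def FullyBounded : {n : ℕ} → Fml L n → Prop
  | _, eq _ _ => True
  | _, rel _ _ => True
  | _, neg φ => FullyBounded φ
  | _, and φ ψ => FullyBounded φ ∧ FullyBounded ψ
  | _, or φ ψ => FullyBounded φ ∧ FullyBounded ψ
  | _, imp φ ψ => FullyBounded φ ∧ FullyBounded ψ
  | _, all _ => False
  | _, ex _ => False
  | _, ball _ φ => FullyBounded φ
  | _, bex _ φ => FullyBounded φ

/-- The substitution `σ` carried under a quantifier: the bound variable is kept. -/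
def liftSubst {n m : ℕ} (σ : Fin n → L.Term (Fin m)) : Fin (n + 1) → L.Term (Fin (m + 1)) :=
  Fin.snoc (α := fun _ => L.Term (Fin (m + 1))) (fun i => (σ i).relabel Fin.castSucc)
    (FirstOrder.Language.Term.var (Fin.last m))

/-- Simultaneous substitution of the terms `σ i` for the free variables of a formula. -/
def subst : {n m : ℕ} → Fml L n → (Fin n → L.Term (Fin m)) → Fml L m
  | _, _, eq s t, σ => eq (s.subst σ) (t.subst σ)
  | _, _, rel R ts, σ => rel R (fun i => (ts i).subst σ)
  | _, _, neg φ, σ => neg (subst φ σ)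
  | _, _, and φ ψ, σ => and (subst φ σ) (subst ψ σ)
  | _, _, or φ ψ, σ => or (subst φ σ) (subst ψ σ)
  | _, _, imp φ ψ, σ => imp (subst φ σ) (subst ψ σ)
  | _, _, all φ, σ => all (subst φ (liftSubst σ))
  | _, _, ex φ, σ => ex (subst φ (liftSubst σ))
  | _, _, ball t φ, σ => ball (t.subst σ) (subst φ (liftSubst σ))
  | _, _, bex t φ, σ => bex (t.subst σ) (subst φ (liftSubst σ))

/-- `∀ v₀ … ∀ v₍ₖ₋₁₎ φ`. -/
def alls : {k : ℕ} → Fml L k → Fml L 0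
  | 0, φ => φ
  | _ + 1, φ => alls (all φ)

/-- `∃ v₀ … ∃ v₍ₖ₋₁₎ φ`. -/
def exs : {k : ℕ} → Fml L k → Fml L 0
  | 0, φ => φ
  | _ + 1, φ => exs (ex φ)

end Fml

/-! ### Languages, deduction methods and encodings -/

/-- A language with `0`, `1`, `2`, `≤`, `max`, its standard interpretation in the natural numbers,
and for every natural number `k` a closed term `num k` that denotes `k`. (Equality is a logical
symbol, see `Fml.eq`; further function and relation symbols are allowed.) -/
structure ArithLanguage where
  L : FirstOrder.Language.{0, 0}
  zero : L.Functions 0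
  one : L.Functions 0
  two : L.Functions 0
  max : L.Functions 2
  le : L.Relations 2
  std : L.Structure ℕ
  std_zero : std.funMap zero ![] = 0
  std_one : std.funMap one ![] = 1
  std_two : std.funMap two ![] = 2
  std_max : ∀ a b : ℕ, std.funMap max ![a, b] = Nat.max a b
  std_le : ∀ a b : ℕ, std.RelMap le ![a, b] ↔ a ≤ b
  num : ℕ → L.Term Empty
  std_num : ∀ k : ℕ, (num k).realize (Empty.elim : Empty → ℕ) = k

namespace ArithLanguage

variable (A : ArithLanguage)

instance : A.L.Structure ℕ := A.std

/-- The term `num k`, regarded as a term in `n` variables. -/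
def numeral {n : ℕ} (k : ℕ) : A.L.Term (Fin n) := (A.num k).relabel Empty.elim

/-- `M` (with its own equality) is a model of the sentence `φ`. -/
def Models (M : Type) [A.L.Structure M] (φ : Fml A.L 0) : Prop :=
  φ.Realize (M := M) A.le Eq Set.univ Fin.elim0

/-- `M` is a model of `φ` when the equality sign is read as the binary relation `E`. -/
def ModelsWith (M : Type) [A.L.Structure M] (E : M → M → Prop) (φ : Fml A.L 0) : Prop :=
  φ.Realize A.le E Set.univ Fin.elim0

/-- Truth in the standard model under an assignment. -/
def Holds {n : ℕ} (φ : Fml A.L n) (v : Fin n → ℕ) : Prop :=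
  φ.Realize A.le Eq Set.univ v

/-- Truth of a sentence in the standard model. -/
def IsTrue (φ : Fml A.L 0) : Prop := A.Holds φ Fin.elim0

end ArithLanguage

/-- A method of deduction for first-order logic over the given language. `IsProof X φ π` says that
`π` is a proof of the sentence `φ` from the axiom system `X`. The method is sound, and it is
complete in the sense of Gödel's completeness theorem. Completeness is demanded only for
consequences that do not use the special role of equality, so that calculi without equality
rules (such as plain semantic tableaux) are included. -/
structure DeductionMethod (A : ArithLanguage) where
  Proof : Type
  IsProof : Set (Fml A.L 0) → Fml A.L 0 → Proof → Prop
  mono : ∀ {X Y : Set (Fml A.L 0)} {φ : Fml A.L 0} {π : Proof},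
    X ⊆ Y → IsProof X φ π → IsProof Y φ π
  sound : ∀ {X : Set (Fml A.L 0)} {φ : Fml A.L 0} {π : Proof}, IsProof X φ π →
    ∀ (M : Type) [A.L.Structure M] [Nonempty M],
      (∀ ψ ∈ X, A.Models M ψ) → A.Models M φ
  complete : ∀ {X : Set (Fml A.L 0)} {φ : Fml A.L 0},
    (∀ (M : Type) [A.L.Structure M] [Nonempty M] (E : M → M → Prop),
      (∀ ψ ∈ X, A.ModelsWith M E ψ) → A.ModelsWith M E φ) →
    ∃ π : Proof, IsProof X φ π

/-- A Gödel numbering of formulas and of proofs. Substituting numerals is an effective operation on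
the Gödel numbers of formulas; a proof displays the theorem that it proves and the axioms that it
uses, and hence its Gödel number is no smaller than theirs. -/
structure GodelEncoding (A : ArithLanguage) (d : DeductionMethod A) where
  gn : {n : ℕ} → Fml A.L n → ℕ
  gn_inj : Function.Injective (fun φ : (Σ n : ℕ, Fml A.L n) => gn φ.2)
  gn_subst : ∃ s : ℕ → ℕ → ℕ, Computable₂ s ∧
    ∀ (φ : Fml A.L 1) (k : ℕ), s (gn φ) k = gn (φ.subst (m := 0) ![A.numeral k])
  code : d.Proof → ℕ
  code_inj : Function.Injective code
  theorem_le : ∀ {X : Set (Fml A.L 0)} {φ : Fml A.L 0} {π : d.Proof},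
    d.IsProof X φ π → gn φ ≤ code π
  axioms_le : ∀ {X : Set (Fml A.L 0)} {φ : Fml A.L 0} {π : d.Proof},
    d.IsProof X φ π → d.IsProof {ψ ∈ X | gn ψ ≤ code π} φ π

/-! ### Generic configurations -/

/-- The class `Δ₀` of a configuration: a class of fully bounded formulas, closed under the Boolean
connectives, under quantification bounded by a variable, and under replacing variables by
variables or by numerals, and rich enough to define the graphs of addition and multiplication. -/
structure DeltaZeroClass (A : ArithLanguage) where
  Mem : {n : ℕ} → Fml A.L n → Prop
  fullyBounded : ∀ {n : ℕ} {φ : Fml A.L n}, Mem φ → φ.FullyBounded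
  neg : ∀ {n : ℕ} {φ : Fml A.L n}, Mem φ → Mem φ.neg
  and : ∀ {n : ℕ} {φ ψ : Fml A.L n}, Mem φ → Mem ψ → Mem (φ.and ψ)
  or : ∀ {n : ℕ} {φ ψ : Fml A.L n}, Mem φ → Mem ψ → Mem (φ.or ψ)
  ball : ∀ {n : ℕ} (i : Fin n) {φ : Fml A.L (n + 1)}, Mem φ → Mem (Fml.ball (.var i) φ)
  bex : ∀ {n : ℕ} (i : Fin n) {φ : Fml A.L (n + 1)}, Mem φ → Mem (Fml.bex (.var i) φ)
  subst : ∀ {n m : ℕ} {φ : Fml A.L n} (σ : Fin n → A.L.Term (Fin m)),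
    (∀ i, (∃ j, σ i = .var j) ∨ ∃ k, σ i = A.numeral k) → Mem φ → Mem (φ.subst σ)
  add : ∃ φ : Fml A.L 3, Mem φ ∧ ∀ x y z : ℕ, A.Holds φ ![x, y, z] ↔ x + y = z
  mult : ∃ φ : Fml A.L 3, Mem φ ∧ ∀ x y z : ℕ, A.Holds φ ![x, y, z] ↔ x * y = z

namespace DeltaZeroClass

variable {A : ArithLanguage} (Δ : DeltaZeroClass A)

/-- `Π₁` sentences: `∀ v₁ … ∀ vₖ φ` with `φ` in `Δ₀`. -/
def IsPi1 (Ψ : Fml A.L 0) : Prop :=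
  ∃ (k : ℕ) (φ : Fml A.L k), Δ.Mem φ ∧ Ψ = φ.alls

/-- `Σ₁` sentences: `∃ v₁ … ∃ vₖ φ` with `φ` in `Δ₀`. -/
def IsSigma1 (Ψ : Fml A.L 0) : Prop :=
  ∃ (k : ℕ) (φ : Fml A.L k), Δ.Mem φ ∧ Ψ = φ.exs

/-- `Ψ` is a `Π₁` sentence `∀ v₁ … ∀ vₖ φ` and `Ψ'` is the `Σ₁` sentence `∃ v₁ … ∃ vₖ ¬ φ`
that represents its negation. -/
def IsNegation (Ψ Ψ' : Fml A.L 0) : Prop :=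
  ∃ (k : ℕ) (φ : Fml A.L k), Δ.Mem φ ∧ Ψ = φ.alls ∧ Ψ' = φ.neg.exs

end DeltaZeroClass

/-- A generic configuration: a language, a class `Δ₀`, a method of deduction, an encoding of proofs,
and a base axiom system whose axioms are true in the standard model and which proves every true
`Σ₁` sentence. -/
structure GenericConfiguration where
  A : ArithLanguage
  Δ : DeltaZeroClass A
  d : DeductionMethod A
  g : GodelEncoding A d
  B : Set (Fml A.L 0)
  B_true : ∀ φ ∈ B, A.IsTrue φ
  B_complete : ∀ φ, Δ.IsSigma1 φ → A.IsTrue φ → ∃ π, d.IsProof B φ π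

namespace GenericConfiguration

variable (ξ : GenericConfiguration)

/-- The sentences of the language of `ξ`. -/
abbrev Sentence : Type := Fml ξ.A.L 0

/-- `p` is the Gödel number of a proof of `φ` from `X`. -/
def PrfNum (X : Set ξ.Sentence) (φ : ξ.Sentence) (p : ℕ) : Prop :=
  ∃ π, ξ.d.IsProof X φ π ∧ ξ.g.code π = p

/-- The axiom system `X` proves `φ` by the deduction method of `ξ`. -/
def Proves (X : Set ξ.Sentence) (φ : ξ.Sentence) : Prop :=
  ∃ π, ξ.d.IsProof X φ π

/-! ### Stability -/

/-- `2 ^ N` for an extended real number `N`. -/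
noncomputable def pow2 (N : EReal) : EReal :=
  if N = ⊤ then ⊤ else if N = ⊥ then 0 else (((2 : ℝ) ^ N.toReal : ℝ) : EReal)

/-- A (prenex) sentence is `Good N` if it is true in the standard model once each of its unbounded
quantifiers is restricted to the numbers `v < 2 ^ N`. -/
def Good (N : EReal) (φ : ξ.Sentence) : Prop :=
  φ.Realize ξ.A.le Eq {v : ℕ | (v : EReal) < pow2 N} Fin.elim0

/-- `♯ θ`: the largest `J` such that every sentence of `θ` is `Good J`. It is `⊤` if there are
arbitrarily large such `J`, and `⊥` if there is none. -/
noncomputable def sharp (θ : Set ξ.Sentence) : EReal :=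
  sSup {x : EReal | ∃ J : ℕ, x = (J : EReal) ∧ ∀ φ ∈ θ, ξ.Good (J : EReal) φ}

/-- An R-view: a recursively enumerable set of `Π₁` sentences (true or not). -/
def IsRView (θ : Set ξ.Sentence) : Prop :=
  (∀ φ ∈ θ, ξ.Δ.IsPi1 φ) ∧ REPred (fun c : ℕ => ∃ φ ∈ θ, ξ.g.gn φ = c)

/-- A-stability: `Π₁` theorems of `θ ∪ B` that have short proofs are `Good (♯ θ / 2)`. -/
def AStable : Prop :=
  ∀ θ, ξ.IsRView θ → ∀ (φ : ξ.Sentence) (p : ℕ), ξ.Δ.IsPi1 φ → ξ.PrfNum (θ ∪ ξ.B) φ p →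
    (Real.logb 2 p : EReal) ≤ ξ.sharp θ + 1 →
    ξ.Good (((1 / 2 : ℝ) : EReal) * ξ.sharp θ) φ

/-- E-stability: `Σ₁` theorems of `θ ∪ B` that have a short proof `p` are
`Good (⌊log₂ p⌋ / 2 - 1)`. -/
def EStable : Prop :=
  ∀ θ, ξ.IsRView θ → ∀ (φ : ξ.Sentence) (p : ℕ), ξ.Δ.IsSigma1 φ → ξ.PrfNum (θ ∪ ξ.B) φ p →
    (Real.logb 2 p : EReal) ≤ ξ.sharp θ + 1 →
    ξ.Good (((1 / 2 : ℝ) * (⌊Real.logb 2 p⌋ : ℝ) - 1 : ℝ) : EReal) φ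

/-- EA-stability. -/
def EAStable : Prop := ξ.EStable ∧ ξ.AStable

end GenericConfiguration

/-! ### Formalized provability -/

/-- A choice of the `Δ₀` formulas by which the syntax of `ξ` is expressed in its language; each of
them is determined up to equivalence in the standard model by the relation it stands for. -/
structure Arithmetization (ξ : GenericConfiguration) where
  /-- `Neg¹(x, y)`: `x` is a `Π₁` sentence and `y` is the `Σ₁` sentence that is its negation. -/
  neg1 : Fml ξ.A.L 2
  neg1_mem : ξ.Δ.Mem neg1
  neg1_spec : ∀ x y : ℕ, ξ.A.Holds neg1 ![x, y] ↔
    ∃ Ψ Ψ', ξ.Δ.IsNegation Ψ Ψ' ∧ ξ.g.gn Ψ = x ∧ ξ.g.gn Ψ' = y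
  /-- `Prf_B(t, p)`: `p` is a proof of the sentence `t` from `B`. -/
  prf : Fml ξ.A.L 2
  prf_mem : ξ.Δ.Mem prf
  prf_spec : ∀ t p : ℕ, ξ.A.Holds prf ![t, p] ↔
    ∃ φ, ξ.PrfNum ξ.B φ p ∧ ξ.g.gn φ = t
  /-- `ExPrf_B(h, t, p)`: `p` is a proof of the sentence `t` from `B` and the sentence `h`. -/
  exPrf : Fml ξ.A.L 3
  exPrf_mem : ξ.Δ.Mem exPrf
  exPrf_spec : ∀ h t p : ℕ, ξ.A.Holds exPrf ![h, t, p] ↔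
    ∃ χ φ : ξ.Sentence, ξ.PrfNum (ξ.B ∪ {χ}) φ p ∧ ξ.g.gn χ = h ∧ ξ.g.gn φ = t
  /-- `Subst(g, h)`: `g` is a formula and `h` is the sentence that results from `g` when all its
  free variables are replaced by the numeral of `g`. -/
  sub : Fml ξ.A.L 2
  sub_mem : ξ.Δ.Mem sub
  sub_spec : ∀ g h : ℕ, ξ.A.Holds sub ![g, h] ↔
    ∃ (n : ℕ) (φ : Fml ξ.A.L n), ξ.g.gn φ = g ∧
      ξ.g.gn (φ.subst (m := 0) (fun _ => ξ.A.numeral g)) = h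

namespace Arithmetization

variable {ξ : GenericConfiguration} (F : Arithmetization ξ)

/-- The variable `vᵢ` as a term. -/
abbrev v {L : FirstOrder.Language.{0, 0}} {n : ℕ} (i : Fin n) : L.Term (Fin n) := FirstOrder.Language.Term.var i

/-- `SubstPrf(g, t, p) := Prf_B(t, p) ∨ ∃ h ≤ p, Subst(g, h) ∧ ExPrf_B(h, t, p)`, in the variables
`g = v₀`, `t = v₁`, `p = v₂` (and `h = v₃`). -/
def substPrf : Fml ξ.A.L 3 :=
  .or (F.prf.subst ![v 1, v 2])
    (.bex (v 2) (.and (F.sub.subst ![v 0, v 3]) (F.exPrf.subst ![v 3, v 1, v 2])))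

/-- `Γ(g) := ∀ x ∀ y ∀ p ∀ q ¬ (Neg¹(x, y) ∧ SubstPrf(g, x, p) ∧ SubstPrf(g, y, q))`, in the
variables `g = v₀`, `x = v₁`, `y = v₂`, `p = v₃`, `q = v₄`. -/
def gamma : Fml ξ.A.L 1 :=
  .all <| .all <| .all <| .all <| .neg <|
    .and (F.neg1.subst ![v 1, v 2])
      (.and (F.substPrf.subst ![v 0, v 1, v 3]) (F.substPrf.subst ![v 0, v 2, v 4]))

/-- `SelfCons¹(B)`: the sentence `Γ(n)` for the Gödel number `n` of `Γ`. -/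
def selfCons : ξ.Sentence := F.gamma.subst ![ξ.A.numeral (ξ.g.gn F.gamma)]

/-- The axiom system `α = B + SelfCons¹(B)`. -/
def alpha : Set ξ.Sentence := ξ.B ∪ {F.selfCons}

/-- `Prf_α(t, p) := SubstPrf(n, t, p)` for the Gödel number `n` of `Γ`, in the variables `t = v₀`,
`p = v₁`. -/
def prfAlpha : Fml ξ.A.L 2 :=
  F.substPrf.subst ![ξ.A.numeral (ξ.g.gn F.gamma), v 0, v 1]

/-- `NegPrf(t, x) := ∃ y ≤ x, Neg¹(t, y) ∧ Prf_B(y, x)`: `t` is a `Π₁` sentence and `x` is a proof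
from `B` of its negation. The variables are `t = v₀`, `x = v₁` (and `y = v₂`). -/
def negPrf : Fml ξ.A.L 2 :=
  .bex (v 1) (.and (F.neg1.subst ![v 0, v 2]) (F.prf.subst ![v 2, v 1]))

/-- `Test₀(t, x) := ¬ NegPrf(t, x)`. -/
def test0 : Fml ξ.A.L 2 := .neg F.negPrf

/-- The sentence `∀ x Test₀(⌜Ψ⌝, x)`. -/
def translate (Ψ : ξ.Sentence) : ξ.Sentence :=
  (Fml.all F.test0).subst ![ξ.A.numeral (ξ.g.gn Ψ)]

/-- The sentence `∀ p (Prf_α(⌜Ψ⌝, p) → Θ)`. -/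
def reflection (Ψ Θ : ξ.Sentence) : ξ.Sentence :=
  .all (.imp (F.prfAlpha.subst ![ξ.A.numeral (ξ.g.gn Ψ), v 0]) (Θ.subst Fin.elim0))

end Arithmetization

namespace Fml

variable {L : FirstOrder.Language.{0, 0}} {M : Type} [L.Structure M]

theorem realize_liftSubst {n m : ℕ} (σ : Fin n → L.Term (Fin m)) (v : Fin m → M) (a : M) :
    (fun i => (liftSubst σ i).realize (Fin.snoc (α := fun _ => M) v a)) =
      Fin.snoc (α := fun _ => M) (fun i => (σ i).realize v) a := by
  funext i
  refine Fin.lastCases ?_ (fun j => ?_) i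
  · simp [liftSubst]
  · simp only [liftSubst, Fin.snoc_castSucc, FirstOrder.Language.Term.realize_relabel]
    congr 1
    funext k
    simp

theorem realize_subst (le : L.Relations 2) (E : M → M → Prop) (D : Set M) {n : ℕ} (φ : Fml L n) :
    ∀ {m : ℕ} (σ : Fin n → L.Term (Fin m)) (v : Fin m → M),
      (φ.subst σ).Realize le E D v ↔ φ.Realize le E D (fun i => (σ i).realize v) := by
  induction φ with
  | eq s t => intros; simp [subst, Realize, FirstOrder.Language.Term.realize_subst]
  | rel R ts => intros; simp [subst, Realize, FirstOrder.Language.Term.realize_subst]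
  | neg φ ih => intros; simp only [subst, Realize, ih]
  | and φ ψ ih ih' => intros; simp only [subst, Realize, ih, ih']
  | or φ ψ ih ih' => intros; simp only [subst, Realize, ih, ih']
  | imp φ ψ ih ih' => intros; simp only [subst, Realize, ih, ih']
  | all φ ih => intros; simp only [subst, Realize, ih, realize_liftSubst]
  | ex φ ih => intros; simp only [subst, Realize, ih, realize_liftSubst]
  | ball t φ ih =>
    intros
    simp only [subst, Realize, ih, realize_liftSubst, FirstOrder.Language.Term.realize_subst]
  | bex t φ ih =>
    intros
    simp only [subst, Realize, ih, realize_liftSubst, FirstOrder.Language.Term.realize_subst]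

theorem realize_alls (le : L.Relations 2) (E : M → M → Prop) {k : ℕ} (φ : Fml L k) :
    φ.alls.Realize le E Set.univ (Fin.elim0 : Fin 0 → M) ↔
      ∀ v : Fin k → M, φ.Realize le E Set.univ v := by
  induction k with
  | zero => exact ⟨fun h v => by rwa [Subsingleton.elim v Fin.elim0], fun h => h _⟩
  | succ k ih =>
    rw [alls, ih]
    exact ⟨fun h v => by simpa using h (Fin.init v) (v (Fin.last k)) trivial,
      fun h v a _ => h _⟩

theorem realize_exs (le : L.Relations 2) (E : M → M → Prop) {k : ℕ} (φ : Fml L k) :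
    φ.exs.Realize le E Set.univ (Fin.elim0 : Fin 0 → M) ↔
      ∃ v : Fin k → M, φ.Realize le E Set.univ v := by
  induction k with
  | zero => exact ⟨fun h => ⟨_, h⟩, fun ⟨v, h⟩ => by rwa [Subsingleton.elim v Fin.elim0] at h⟩
  | succ k ih =>
    rw [exs, ih]
    exact ⟨fun ⟨v, a, _, h⟩ => ⟨_, h⟩,
      fun ⟨v, h⟩ => ⟨Fin.init v, v (Fin.last k), trivial, by simpa using h⟩⟩

end Fml

namespace ArithLanguage

variable (A : ArithLanguage)

theorem realize_numeral {M : Type} [A.L.Structure M] {n : ℕ} (k : ℕ) (v : Fin n → M) :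
    (A.numeral k : A.L.Term (Fin n)).realize v = (A.num k).realize Empty.elim := by
  rw [numeral, FirstOrder.Language.Term.realize_relabel]
  congr 1
  exact Subsingleton.elim _ _

theorem relabel_numeral {n m : ℕ} (k : ℕ) (f : Fin n → Fin m) :
    (A.numeral k : A.L.Term (Fin n)).relabel f = A.numeral k := by
  rw [numeral, FirstOrder.Language.Term.relabel_relabel]
  exact congrArg (fun g => (A.num k).relabel g) (Subsingleton.elim _ _)

end ArithLanguage

theorem DeltaZeroClass.IsNegation.isTrue_iff {A : ArithLanguage} {Δ : DeltaZeroClass A}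
    {Ψ Ψ' : Fml A.L 0} (h : Δ.IsNegation Ψ Ψ') : A.IsTrue Ψ' ↔ ¬ A.IsTrue Ψ := by
  obtain ⟨k, φ, -, rfl, rfl⟩ := h
  simp only [ArithLanguage.IsTrue, ArithLanguage.Holds, Fml.realize_alls, Fml.realize_exs,
    Fml.Realize, not_forall]

theorem DeltaZeroClass.IsNegation.isSigma1 {A : ArithLanguage} {Δ : DeltaZeroClass A}
    {Ψ Ψ' : Fml A.L 0} (h : Δ.IsNegation Ψ Ψ') : Δ.IsSigma1 Ψ' := by
  obtain ⟨k, φ, hφ, -, rfl⟩ := h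
  exact ⟨k, φ.neg, Δ.neg hφ, rfl⟩

theorem DeltaZeroClass.IsPi1.exists_isNegation {A : ArithLanguage} {Δ : DeltaZeroClass A}
    {Ψ : Fml A.L 0} (h : Δ.IsPi1 Ψ) : ∃ Ψ', Δ.IsNegation Ψ Ψ' := by
  obtain ⟨k, φ, hφ, rfl⟩ := h
  exact ⟨_, k, φ, hφ, rfl, rfl⟩

namespace GenericConfiguration

variable {ξ : GenericConfiguration}

theorem gn_injective {φ ψ : ξ.Sentence} (h : ξ.g.gn φ = ξ.g.gn ψ) : φ = ψ :=
  eq_of_heq (Sigma.mk.inj (ξ.g.gn_inj (a₁ := ⟨0, φ⟩) (a₂ := ⟨0, ψ⟩) h)).2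

theorem PrfNum.gn_le {X : Set ξ.Sentence} {φ : ξ.Sentence} {p : ℕ} (h : ξ.PrfNum X φ p) :
    ξ.g.gn φ ≤ p := by
  obtain ⟨π, hπ, rfl⟩ := h
  exact ξ.g.theorem_le hπ

theorem PrfNum.mono {X Y : Set ξ.Sentence} (hXY : X ⊆ Y) {φ : ξ.Sentence} {p : ℕ}
    (h : ξ.PrfNum X φ p) : ξ.PrfNum Y φ p := by
  obtain ⟨π, hπ, hp⟩ := h
  exact ⟨π, ξ.d.mono hXY hπ, hp⟩

theorem PrfNum.restrict {X : Set ξ.Sentence} {φ : ξ.Sentence} {p : ℕ} (h : ξ.PrfNum X φ p) :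
    ξ.PrfNum {ψ ∈ X | ξ.g.gn ψ ≤ p} φ p := by
  obtain ⟨π, hπ, rfl⟩ := h
  exact ⟨π, ξ.g.axioms_le hπ, rfl⟩

theorem PrfNum.isTrue {φ : ξ.Sentence} {p : ℕ} (h : ξ.PrfNum ξ.B φ p) : ξ.A.IsTrue φ := by
  obtain ⟨π, hπ, -⟩ := h
  exact ξ.d.sound hπ ℕ ξ.B_true

/-- A `Π₁` sentence is true if and only if `B` does not refute it. -/
theorem isTrue_iff_not_refutable {Ψ : ξ.Sentence} (hΨ : ξ.Δ.IsPi1 Ψ) :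
    ξ.A.IsTrue Ψ ↔ ∀ x, ¬ ∃ Ψ', ξ.Δ.IsNegation Ψ Ψ' ∧ ξ.PrfNum ξ.B Ψ' x := by
  constructor
  · rintro h x ⟨Ψ', hneg, hprf⟩
    exact hneg.isTrue_iff.1 hprf.isTrue h
  · intro h
    by_contra hfalse
    obtain ⟨Ψ', hneg⟩ := hΨ.exists_isNegation
    obtain ⟨π, hπ⟩ := ξ.B_complete Ψ' hneg.isSigma1 (hneg.isTrue_iff.2 hfalse)
    exact h _ ⟨Ψ', hneg, π, hπ, rfl⟩

end GenericConfiguration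

namespace Arithmetization

variable {ξ : GenericConfiguration} (F : Arithmetization ξ)

section Semantics

variable {M : Type} [ξ.A.L.Structure M] (E : M → M → Prop)

theorem realize_substPrf (g t p : M) :
    F.substPrf.Realize ξ.A.le E Set.univ ![g, t, p] ↔
      F.prf.Realize ξ.A.le E Set.univ ![t, p] ∨
      ∃ h, FirstOrder.Language.Structure.RelMap ξ.A.le ![h, p] ∧
        F.sub.Realize ξ.A.le E Set.univ ![g, h] ∧
        F.exPrf.Realize ξ.A.le E Set.univ ![h, t, p] := by
  simp only [substPrf, Fml.Realize, Fml.realize_subst]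
  refine or_congr (iff_of_eq (congrArg _ ?_)) (exists_congr fun h => and_congr Iff.rfl
    (and_congr (iff_of_eq (congrArg _ ?_)) (iff_of_eq (congrArg _ ?_)))) <;>
  · funext i
    fin_cases i <;> rfl

theorem realize_prfAlpha (t p : M) :
    F.prfAlpha.Realize ξ.A.le E Set.univ ![t, p] ↔
      F.substPrf.Realize ξ.A.le E Set.univ
        ![(ξ.A.num (ξ.g.gn F.gamma)).realize Empty.elim, t, p] := by
  rw [prfAlpha, Fml.realize_subst]
  refine iff_of_eq (congrArg _ ?_)
  funext i
  fin_cases i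
  · exact ξ.A.realize_numeral _ _
  · rfl
  · rfl

theorem realize_negPrf (t x : M) :
    F.negPrf.Realize ξ.A.le E Set.univ ![t, x] ↔
      ∃ y, FirstOrder.Language.Structure.RelMap ξ.A.le ![y, x] ∧
        F.neg1.Realize ξ.A.le E Set.univ ![t, y] ∧
        F.prf.Realize ξ.A.le E Set.univ ![y, x] := by
  simp only [negPrf, Fml.Realize, Fml.realize_subst]
  refine exists_congr fun y => and_congr Iff.rfl
    (and_congr (iff_of_eq (congrArg _ ?_)) (iff_of_eq (congrArg _ ?_))) <;>
  · funext i
    fin_cases i <;> rfl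

theorem realize_selfCons :
    F.selfCons.Realize ξ.A.le E Set.univ (Fin.elim0 : Fin 0 → M) ↔
      ∀ x y p q : M, ¬ (F.neg1.Realize ξ.A.le E Set.univ ![x, y] ∧
        F.prfAlpha.Realize ξ.A.le E Set.univ ![x, p] ∧
        F.prfAlpha.Realize ξ.A.le E Set.univ ![y, q]) := by
  rw [selfCons, Fml.realize_subst]
  simp only [gamma, Fml.Realize, Fml.realize_subst, realize_prfAlpha, Set.mem_univ,
    true_implies]
  refine forall_congr' fun x => forall_congr' fun y => forall_congr' fun p =>
    forall_congr' fun q => not_congr (and_congr (iff_of_eq (congrArg _ ?_))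
      (and_congr (iff_of_eq (congrArg _ ?_)) (iff_of_eq (congrArg _ ?_)))) <;>
  · funext i
    fin_cases i <;> first | rfl | exact ξ.A.realize_numeral _ _

theorem realize_translate (Ψ : ξ.Sentence) :
    (F.translate Ψ).Realize ξ.A.le E Set.univ (Fin.elim0 : Fin 0 → M) ↔
      ∀ x : M, F.test0.Realize ξ.A.le E Set.univ
        ![(ξ.A.num (ξ.g.gn Ψ)).realize Empty.elim, x] := by
  rw [translate, Fml.realize_subst]
  simp only [Fml.Realize, Set.mem_univ, true_implies]
  refine forall_congr' fun x => iff_of_eq (congrArg _ ?_)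
  funext i
  fin_cases i
  · exact ξ.A.realize_numeral _ _
  · rfl

theorem realize_reflection (Ψ Θ : ξ.Sentence) :
    (F.reflection Ψ Θ).Realize ξ.A.le E Set.univ (Fin.elim0 : Fin 0 → M) ↔
      ∀ p : M, F.prfAlpha.Realize ξ.A.le E Set.univ
          ![(ξ.A.num (ξ.g.gn Ψ)).realize Empty.elim, p] →
        Θ.Realize ξ.A.le E Set.univ (Fin.elim0 : Fin 0 → M) := by
  simp only [reflection, Fml.Realize, Fml.realize_subst, Set.mem_univ, true_implies]
  refine forall_congr' fun p => imp_congr (iff_of_eq (congrArg _ ?_))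
    (iff_of_eq (congrArg _ (Subsingleton.elim _ _)))
  funext i
  fin_cases i
  · exact ξ.A.realize_numeral _ _
  · rfl

/-- Self-consistency forbids a proof of `Ψ` from `α` next to a refutation of `Ψ` from `B`. -/
theorem realize_reflection_of_selfCons
    (h : F.selfCons.Realize ξ.A.le E Set.univ (Fin.elim0 : Fin 0 → M)) (Ψ : ξ.Sentence) :
    (F.reflection Ψ (F.translate Ψ)).Realize ξ.A.le E Set.univ (Fin.elim0 : Fin 0 → M) := by
  rw [realize_selfCons] at h
  rw [realize_reflection]
  intro p hp
  rw [realize_translate]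
  intro x hx
  obtain ⟨y, -, hneg, hprf⟩ := (F.realize_negPrf E _ x).1 hx
  refine h _ y p x ⟨hneg, hp, ?_⟩
  rw [realize_prfAlpha, realize_substPrf]
  exact Or.inl hprf

end Semantics

theorem proves_reflection (Ψ : ξ.Sentence) :
    ξ.Proves F.alpha (F.reflection Ψ (F.translate Ψ)) :=
  ξ.d.complete fun _ _ _ E hα =>
    F.realize_reflection_of_selfCons E (hα _ (Or.inr rfl)) Ψ

theorem holds_sub_gamma (h : ℕ) :
    ξ.A.Holds F.sub ![ξ.g.gn F.gamma, h] ↔ h = ξ.g.gn F.selfCons := by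
  have key : F.gamma.subst (m := 0) (fun _ => ξ.A.numeral (ξ.g.gn F.gamma)) = F.selfCons := by
    rw [selfCons]
    congr 1
    funext i
    fin_cases i
    rfl
  rw [F.sub_spec]
  constructor
  · rintro ⟨n, φ, hφ, rfl⟩
    have := ξ.g.gn_inj (a₁ := ⟨n, φ⟩) (a₂ := ⟨1, F.gamma⟩) hφ
    cases this
    rw [key]
  · rintro rfl
    exact ⟨1, F.gamma, rfl, by rw [key]⟩

theorem holds_prfAlpha (t p : ℕ) :
    ξ.A.Holds F.prfAlpha ![t, p] ↔ ∃ φ, ξ.PrfNum F.alpha φ p ∧ ξ.g.gn φ = t := by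
  have hnum : (ξ.A.num (ξ.g.gn F.gamma)).realize (Empty.elim : Empty → ℕ) = ξ.g.gn F.gamma :=
    ξ.A.std_num _
  have hsem : ξ.A.Holds F.prfAlpha ![t, p] ↔ ξ.A.Holds F.prf ![t, p] ∨
      ∃ h, h ≤ p ∧ ξ.A.Holds F.sub ![ξ.g.gn F.gamma, h] ∧ ξ.A.Holds F.exPrf ![h, t, p] := by
    simp only [ArithLanguage.Holds]
    rw [realize_prfAlpha, realize_substPrf, hnum]
    exact or_congr Iff.rfl (exists_congr fun h => and_congr (ξ.A.std_le h p) Iff.rfl)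
  rw [hsem, F.prf_spec]
  simp only [holds_sub_gamma, F.exPrf_spec]
  constructor
  · rintro (⟨φ, hφ, ht⟩ | ⟨h, -, rfl, χ, φ, hφ, hχ, ht⟩)
    · exact ⟨φ, hφ.mono Set.subset_union_left, ht⟩
    · rw [GenericConfiguration.gn_injective hχ] at hφ
      exact ⟨φ, hφ, ht⟩
  · rintro ⟨φ, hφ, ht⟩
    by_cases hle : ξ.g.gn F.selfCons ≤ p
    · exact Or.inr ⟨_, hle, rfl, _, φ, hφ, rfl, ht⟩
    · refine Or.inl ⟨φ, hφ.restrict.mono ?_, ht⟩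
      rintro ψ ⟨hψ | rfl, hψp⟩
      · exact hψ
      · exact absurd hψp hle

theorem holds_test0 (Ψ : ξ.Sentence) (x : ℕ) :
    ξ.A.Holds F.test0 ![ξ.g.gn Ψ, x] ↔
      ¬ ∃ Ψ', ξ.Δ.IsNegation Ψ Ψ' ∧ ξ.PrfNum ξ.B Ψ' x := by
  refine not_congr ((F.realize_negPrf Eq (ξ.g.gn Ψ) x).trans ⟨?_, ?_⟩)
  · rintro ⟨y, -, hneg, hprf⟩
    obtain ⟨Ψ₁, Ψ', hN, h1, rfl⟩ := (F.neg1_spec _ y).1 hneg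
    obtain ⟨φ, hφ, h2⟩ := (F.prf_spec _ x).1 hprf
    rw [GenericConfiguration.gn_injective h1] at hN
    rw [GenericConfiguration.gn_injective h2] at hφ
    exact ⟨Ψ', hN, hφ⟩
  · rintro ⟨Ψ', hN, hprf⟩
    exact ⟨ξ.g.gn Ψ', (ξ.A.std_le _ _).2 hprf.gn_le,
      (F.neg1_spec _ _).2 ⟨Ψ, Ψ', hN, rfl, rfl⟩, (F.prf_spec _ _).2 ⟨Ψ', hprf, rfl⟩⟩

theorem isTrue_translate {Ψ : ξ.Sentence} (hΨ : ξ.Δ.IsPi1 Ψ) :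
    ξ.A.IsTrue (F.translate Ψ) ↔ ξ.A.IsTrue Ψ := by
  have hnum : (ξ.A.num (ξ.g.gn Ψ)).realize (Empty.elim : Empty → ℕ) = ξ.g.gn Ψ :=
    ξ.A.std_num _
  refine (F.realize_translate Eq Ψ).trans ?_
  rw [hnum, GenericConfiguration.isTrue_iff_not_refutable hΨ]
  exact forall_congr' fun x => F.holds_test0 Ψ x

theorem test0_mem : ξ.Δ.Mem F.test0 := by
  refine ξ.Δ.neg (ξ.Δ.bex 1 (ξ.Δ.and (ξ.Δ.subst _ ?_ F.neg1_mem) (ξ.Δ.subst _ ?_ F.prf_mem))) <;>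
  · intro i
    fin_cases i <;> exact Or.inl ⟨_, rfl⟩

theorem isPi1_translate (Ψ : ξ.Sentence) : ξ.Δ.IsPi1 (F.translate Ψ) := by
  refine ⟨1, F.test0.subst (Fml.liftSubst ![ξ.A.numeral (ξ.g.gn Ψ)]),
    ξ.Δ.subst _ ?_ F.test0_mem, rfl⟩
  intro i
  fin_cases i
  · exact Or.inr ⟨_, ξ.A.relabel_numeral _ _⟩
  · exact Or.inl ⟨_, rfl⟩

theorem computable_translate :
    ∃ f : ℕ → ℕ, Computable f ∧ ∀ Ψ, f (ξ.g.gn Ψ) = ξ.g.gn (F.translate Ψ) := by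
  obtain ⟨s, hs, hsub⟩ := ξ.g.gn_subst
  exact ⟨fun k => s (ξ.g.gn (Fml.all F.test0)) k, hs.comp (Computable.const _) Computable.id,
    fun Ψ => hsub _ _⟩

end Arithmetization

theorem mainTheorem3 (ξ : GenericConfiguration) (hξ : ξ.EAStable) (F : Arithmetization ξ) :
    -- the formula `Prf_α` expresses provability from `α` in the standard model
    (∀ t p : ℕ, ξ.A.Holds F.prfAlpha ![t, p] ↔
      ∃ φ, ξ.PrfNum F.alpha φ p ∧ ξ.g.gn φ = t) ∧
    ∃ T : ξ.Sentence → ξ.Sentence,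
      -- `T` is the translation `Ψ ↦ ∀ x Test₀(⌜Ψ⌝, x)`, and it is an algorithm
      (∀ Ψ, T Ψ = F.translate Ψ) ∧
      (∃ f : ℕ → ℕ, Computable f ∧ ∀ Ψ, f (ξ.g.gn Ψ) = ξ.g.gn (T Ψ)) ∧
      -- `Test₀(⌜Ψ⌝, x)` says that `x` is not a proof from `B` of the negation of `Ψ`
      (∀ Ψ x, ξ.Δ.IsPi1 Ψ → (ξ.A.Holds F.test0 ![ξ.g.gn Ψ, x] ↔
        ¬ ∃ Ψ', ξ.Δ.IsNegation Ψ Ψ' ∧ ξ.PrfNum ξ.B Ψ' x)) ∧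
      ∀ Ψ, ξ.Δ.IsPi1 Ψ →
        ξ.Δ.IsPi1 (T Ψ) ∧
        (ξ.A.IsTrue (T Ψ) ↔ ξ.A.IsTrue Ψ) ∧
        ξ.Proves F.alpha (F.reflection Ψ (T Ψ)) := by
  exact ⟨F.holds_prfAlpha, F.translate, fun _ => rfl, F.computable_translate,
    fun Ψ x _ => F.holds_test0 Ψ x,
    fun Ψ hΨ => ⟨F.isPi1_translate Ψ, F.isTrue_translate hΨ, F.proves_reflection Ψ⟩⟩
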